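/- There are absolute constants $c>0$ and $\kappa>0$ and an integer $N$ such that the following holds for every integer $n\ge N$ and every set $S$ of exactly $n$ monic polynomials in $\mathbb{C}[x]$. Write $S.S=\{st : s,t\in S\}$ and $S+S=\{s+t : s,t\in S\}$. If $|S.S|<n^{1+c}$, then $|S+S|\ge\kappa n^2$. -/

import Mathlib

open Polynomial
open scoped Pointwise

/-! If |S.S| < n^(1+c), Plünnecke's inequality and Ruzsa covering (`exists_power_classes`) put S
into at most n^(1/4) classes x(y/z)^k with k = 576. There are then at most n quadruples of classes,
so it suffices to bound by O(n) the nontrivial solutions of s + t = u + v in each: the additive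
energy is O(n²), and Cauchy–Schwarz finishes.

Within one quadruple of classes, any four solution vectors form a singular matrix. Its determinant
expands into 4! terms which, up to a common factor, are signed k-th powers of monic polynomials. The
multi-term Fermat theorem (`exists_eq_of_sum_smul_pow_eq_zero`, a Wronskian degree count) forces two
of these powers to have the same base. Pigeonholing such coincidences gives two coordinates in
constant ratio on a positive proportion of solutions (`exists_subset_proportional`). A second round
with three terms makes the surviving solutions proportional to each other, hence determined by their
first entry. -/

/-! ### Wronskians of complex polynomials. -/

/-- Dividing by the gcd scales the Wronskian by a square, and a coprime pair with zero Wronskian is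
constant. -/
theorem exists_eq_C_mul_of_wronskian_eq_zero {a b : ℂ[X]} (hb : b ≠ 0) (h : wronskian a b = 0) :
    ∃ c : ℂ, a = C c * b := by
  obtain ⟨g, hg⟩ : ∃ g, g = EuclideanDomain.gcd a b := ⟨_, rfl⟩
  have hg0 : g ≠ 0 := by
    rw [hg, Ne, EuclideanDomain.gcd_eq_zero_iff]
    exact fun h => hb h.2
  obtain ⟨a', ha'⟩ : g ∣ a := hg ▸ EuclideanDomain.gcd_dvd_left a b
  obtain ⟨b', hb'⟩ : g ∣ b := hg ▸ EuclideanDomain.gcd_dvd_right a b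
  have hco : IsCoprime a' b' := by
    obtain ⟨x, y, hxy⟩ : ∃ x y, g = a * x + b * y := ⟨_, _, hg ▸ EuclideanDomain.gcd_eq_gcd_ab a b⟩
    refine ⟨x, y, mul_left_cancel₀ hg0 ?_⟩
    linear_combination (-1 : ℂ[X]) * hxy - x * ha' - y * hb'
  have hw : wronskian a' b' = 0 := by
    have : wronskian a b = g ^ 2 * wronskian a' b' := by
      simp only [wronskian, ha', hb', derivative_mul]; ring
    rw [this] at h
    exact (mul_eq_zero.1 h).resolve_left (pow_ne_zero _ hg0)
  obtain ⟨h1, h2⟩ := hco.wronskian_eq_zero_iff.1 hw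
  have h1' := eq_C_of_derivative_eq_zero h1
  have h2' := eq_C_of_derivative_eq_zero h2
  have hc : b'.coeff 0 ≠ 0 := by
    intro h0
    rw [h0, C_0] at h2'
    exact hb (by rw [hb', h2', mul_zero])
  refine ⟨a'.coeff 0 / b'.coeff 0, ?_⟩
  rw [ha', hb', h1', h2']
  have : (C (a'.coeff 0 / b'.coeff 0) * C (b'.coeff 0) : ℂ[X]) = C (a'.coeff 0) := by
    rw [← C_mul, div_mul_cancel₀ _ hc]
  simp only [coeff_C_zero]
  linear_combination (-g) * this

/-- The Wronskian matrix has trivial left kernel when its rows are linearly independent. -/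
theorem eq_zero_of_sum_mul_iterate_derivative_eq_zero (r : ℕ) (g : Fin r → ℂ[X])
    (hg : LinearIndependent ℂ g) (b : Fin r → ℂ[X])
    (hb : ∀ j < r, ∑ i, b i * derivative^[j] (g i) = 0) : b = 0 := by
  induction r with
  | zero => exact Subsingleton.elim _ _
  | succ r ih =>
    have hg' : LinearIndependent ℂ (fun i : Fin r => g i.castSucc) :=
      hg.comp _ (Fin.castSucc_injective r)
    by_cases hl : b (Fin.last r) = 0
    · have := ih _ hg' (fun i => b i.castSucc) fun j hj => by
        simpa [Fin.sum_univ_castSucc, hl] using hb j (by omega)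
      funext i
      refine Fin.lastCases hl (fun i => congrFun this i) i
    · exfalso
      -- Differentiating relation j and subtracting relation j + 1 gives a relation with
      -- coefficients `derivative (b i)`. Eliminating the last row between it and relation j leaves
      -- Wronskians as coefficients.
      have key := ih _ hg' (fun i => wronskian (b (Fin.last r)) (b i.castSucc)) fun j hj => by
        have h0 := hb j (by omega)
        have h1 := hb (j + 1) (by omega)
        have h2 : ∑ i, derivative (b i) * derivative^[j] (g i) = 0 := by
          have := congrArg derivative h0
          simp only [derivative_sum, derivative_mul, Finset.sum_add_distrib, derivative_zero,
            ← Function.iterate_succ_apply' (f := derivative)] at this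
          rw [h1, add_zero] at this
          exact this
        rw [Fin.sum_univ_castSucc] at h0 h2
        have : ∑ i : Fin r, wronskian (b (Fin.last r)) (b i.castSucc) *
            derivative^[j] (g i.castSucc) =
            b (Fin.last r) * (∑ i : Fin r, derivative (b i.castSucc) *
              derivative^[j] (g i.castSucc)) - derivative (b (Fin.last r)) *
              ∑ i : Fin r, b i.castSucc * derivative^[j] (g i.castSucc) := by
          rw [Finset.mul_sum, Finset.mul_sum, ← Finset.sum_sub_distrib]
          exact Finset.sum_congr rfl fun i _ => by rw [wronskian]; ring
        rw [this]
        linear_combination b (Fin.last r) * h2 - derivative (b (Fin.last r)) * h0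
      have hc : ∀ i, ∃ c : ℂ, b i = C c * b (Fin.last r) := by
        refine Fin.lastCases ⟨1, by simp⟩ fun i => ?_
        refine exists_eq_C_mul_of_wronskian_eq_zero hl ?_
        rw [← wronskian_neg_eq, neg_eq_zero]
        exact congrFun key i
      choose c hc using hc
      have h0 : ∑ i, c i • g i = 0 := by
        refine (mul_eq_zero.1 ?_).resolve_left hl
        rw [Finset.mul_sum, ← hb 0 (by omega)]
        refine Finset.sum_congr rfl fun i _ => ?_
        rw [hc i, smul_eq_C_mul]
        simp only [Function.iterate_zero, id]
        ring
      have := Fintype.linearIndependent_iff.1 hg c h0 (Fin.last r)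
      exact hl (by rw [hc, this, C_0, zero_mul])

noncomputable def wronskianMatrix {r : ℕ} (g : Fin r → ℂ[X]) : Matrix (Fin r) (Fin r) ℂ[X] :=
  Matrix.of fun i j => derivative^[j] (g i)

theorem det_wronskianMatrix_ne_zero {r : ℕ} {g : Fin r → ℂ[X]} (hg : LinearIndependent ℂ g) :
    (wronskianMatrix g).det ≠ 0 := by
  intro h
  obtain ⟨b, hb, hb0⟩ := Matrix.exists_vecMul_eq_zero_iff.2 h
  refine hb (eq_zero_of_sum_mul_iterate_derivative_eq_zero r g hg b fun j hj => ?_)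
  simpa [Matrix.vecMul, dotProduct, wronskianMatrix] using congrFun hb0 ⟨j, hj⟩

theorem natDegree_det_wronskianMatrix_le {r : ℕ} (g : Fin r → ℂ[X]) :
    (wronskianMatrix g).det.natDegree ≤ ∑ i, (g i).natDegree := by
  rw [← Matrix.det_transpose, Matrix.det_apply]
  refine natDegree_sum_le_of_forall_le _ _ fun σ _ => ?_
  refine (natDegree_smul_le _ _).trans ((natDegree_prod_le _ _).trans ?_)
  refine Finset.sum_le_sum fun i _ => ?_
  exact (natDegree_iterate_derivative _ _).trans (Nat.sub_le _ _)

theorem prod_dvd_det {R n : Type*} [CommRing R] [Fintype n] [DecidableEq n] (A : Matrix n n R)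
    (d : n → R) (h : ∀ i j, d i ∣ A i j) : ∏ i, d i ∣ A.det := by
  choose B hB using h
  have : A = Matrix.of fun i j => d i * Matrix.of B i j := by ext i j; exact hB i j
  rw [this, Matrix.det_mul_column]
  exact dvd_mul_right _ _

/-- By multilinearity, the replacement multiplies the determinant by the nonzero constant `c l`. -/
theorem det_dvd_of_row_relation {r : ℕ} {g : Fin r → ℂ[X]} {g₀ : ℂ[X]} {c : Fin r → ℂ}
    (h : g₀ = ∑ i, c i • g i) {l : Fin r} (hl : c l ≠ 0) :
    (wronskianMatrix (Function.update g l g₀)).det ∣ (wronskianMatrix g).det := by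
  have h1 : wronskianMatrix (Function.update g l g₀) =
      (wronskianMatrix g).updateRow l (∑ k, C (c k) • (wronskianMatrix g) k) := by
    ext1 i j
    rcases eq_or_ne i l with rfl | hi
    · simp [wronskianMatrix, h, Finset.sum_apply, iterate_derivative_sum,
        smul_eq_C_mul]
    · simp [wronskianMatrix, hi]
  rw [h1, Matrix.det_updateRow_sum]
  refine ⟨C (c l)⁻¹, ?_⟩
  rw [smul_eq_mul, mul_right_comm, ← C_mul, mul_inv_cancel₀ hl, C_1, one_mul]

/-! ### The multi-term Fermat theorem. -/

/-- The Wronskian of the powers has degree at most k Σ deg fᵢ, yet is divisible by (f₀ ∏ fᵢ)^(k-r).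
Hence (k-r) deg f₀ ≤ r Σ deg fᵢ ≤ r² deg f₀, while k - r > r². -/
theorem natDegree_eq_zero_of_pow_eq_sum {r k : ℕ} (hk : (r + 1) ^ 2 ≤ k) {f : Fin r → ℂ[X]}
    {f₀ : ℂ[X]} (hf₀ : f₀ ≠ 0) (hf : ∀ i, f i ≠ 0) {c : Fin r → ℂ} (hc : ∀ i, c i ≠ 0)
    (hsum : f₀ ^ k = ∑ i, c i • f i ^ k) (hli : LinearIndependent ℂ fun i => f i ^ k)
    (hdeg : ∀ i, (f i).natDegree ≤ f₀.natDegree)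
    (hroot : ∀ a, f₀.eval a = 0 → ∃ i, (f i).eval a ≠ 0) : f₀.natDegree = 0 := by
  set W := (wronskianMatrix fun i => f i ^ k).det with hW
  have hW0 : W ≠ 0 := det_wronskianMatrix_ne_zero hli
  have hdvd : ∀ h : Fin r → ℂ[X], (∏ i, h i) ^ (k - r) ∣ (wronskianMatrix fun i => h i ^ k).det := by
    intro h
    rw [← Finset.prod_pow]
    refine prod_dvd_det _ _ fun i j => ?_
    exact (pow_dvd_pow _ (by omega)).trans (pow_sub_dvd_iterate_derivative_pow (h i) k j)
  have hP0 : (f₀ * ∏ i, f i) ^ (k - r) ≠ 0 :=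
    pow_ne_zero _ (mul_ne_zero hf₀ (Finset.prod_ne_zero_iff.2 fun i _ => hf i))
  have hdvdW : (f₀ * ∏ i, f i) ^ (k - r) ∣ W := by
    rw [IsAlgClosed.dvd_iff_roots_le_roots hP0 hW0, Multiset.le_iff_count]
    intro a
    rw [count_roots, count_roots]
    have hmono : ∀ {p q : ℂ[X]}, q ≠ 0 → p ∣ q → p.rootMultiplicity a ≤ q.rootMultiplicity a := by
      intro p q hq hpq
      exact (le_rootMultiplicity_iff hq).2 ((pow_rootMultiplicity_dvd p a).trans hpq)
    -- At a root of f₀, some f_l does not vanish: trading row l for f₀^k shows the full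
    -- multiplicity. Elsewhere f₀ contributes nothing.
    by_cases ha : f₀.eval a = 0
    · obtain ⟨l, hl⟩ := hroot a ha
      have h1 := det_dvd_of_row_relation hsum (hc l)
      have h2 : (Function.update (fun i => f i ^ k) l (f₀ ^ k)) =
          fun i => Function.update f l f₀ i ^ k := by
        funext i
        rcases eq_or_ne i l with rfl | hi
        · simp
        · simp [hi]
      rw [h2] at h1
      have h3 := hmono hW0 ((hdvd _).trans h1)
      refine le_trans (le_of_eq ?_) h3
      rw [Finset.prod_update_of_mem (Finset.mem_univ l), ← Finset.mul_prod_erase Finset.univ f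
        (Finset.mem_univ l), Finset.sdiff_singleton_eq_erase,
        show f₀ * (f l * ∏ i ∈ Finset.univ.erase l, f i) =
          f l * (f₀ * ∏ i ∈ Finset.univ.erase l, f i) by ring, mul_pow (f l)]
      have h4 : (f₀ * ∏ i ∈ Finset.univ.erase l, f i) ≠ 0 :=
        mul_ne_zero hf₀ (Finset.prod_ne_zero_iff.2 fun i _ => hf i)
      rw [rootMultiplicity_mul (mul_ne_zero (pow_ne_zero _ (hf l)) (pow_ne_zero _ h4)),
        rootMultiplicity_eq_zero (p := f l ^ (k - r)) (by simp [IsRoot, hl]), zero_add]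
    · have h3 := hmono hW0 (hdvd f)
      rw [mul_pow, rootMultiplicity_mul (by rwa [← mul_pow]),
        rootMultiplicity_eq_zero (p := f₀ ^ (k - r)) (by simp [IsRoot, ha]), zero_add]
      exact h3
  have hd1 := natDegree_le_of_dvd hdvdW hW0
  rw [natDegree_pow, natDegree_mul hf₀ (Finset.prod_ne_zero_iff.2 fun i _ => hf i),
    natDegree_prod _ _ fun i _ => hf i] at hd1
  have hd2 : W.natDegree ≤ k * ∑ i, (f i).natDegree := by
    refine (natDegree_det_wronskianMatrix_le _).trans ?_
    simp [natDegree_pow, Finset.mul_sum]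
  have hd3 : ∑ i, (f i).natDegree ≤ r * f₀.natDegree := by
    simpa using Finset.sum_le_sum fun (i : Fin r) (_ : i ∈ Finset.univ) => hdeg i
  obtain ⟨q, rfl⟩ : ∃ q, k = q + r := ⟨k - r, by nlinarith [Nat.sub_add_cancel (show r ≤ k by nlinarith)]⟩
  rw [Nat.add_sub_cancel] at hd1
  by_contra h0
  have h0' : 0 < f₀.natDegree := Nat.pos_of_ne_zero h0
  have h5 : q * f₀.natDegree ≤ r * ∑ i, (f i).natDegree := by nlinarith
  have h6 : q * f₀.natDegree ≤ (r * r) * f₀.natDegree := by nlinarith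
  have := Nat.le_of_mul_le_mul_right h6 h0'
  nlinarith

/-- The multi-term Fermat theorem for monic complex polynomials. -/
theorem exists_eq_of_sum_smul_pow_eq_zero {ι : Type*} [Fintype ι] {k : ℕ}
    (hk : Fintype.card ι ^ 2 ≤ k) {f : ι → ℂ[X]} (hf : ∀ i, (f i).Monic) {c : ι → ℂ} (hc : c ≠ 0)
    (hsum : ∑ i, c i • f i ^ k = 0) : ∃ i j, i ≠ j ∧ f i = f j := by
  classical
  -- A relation of minimal support makes the powers other than one chosen term independent.
  have hex : ∃ n : ℕ, ∃ c : ι → ℂ, c ≠ 0 ∧ ∑ i, c i • f i ^ k = 0 ∧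
      (Finset.univ.filter fun i => c i ≠ 0).card = n := ⟨_, c, hc, hsum, rfl⟩
  obtain ⟨c, hc, hsum, hcard⟩ := Nat.find_spec hex
  have hmin : ∀ c' : ι → ℂ, ∑ i, c' i • f i ^ k = 0 →
      (Finset.univ.filter fun i => c' i ≠ 0).card < (Finset.univ.filter fun i => c i ≠ 0).card →
      c' = 0 := by
    intro c' h1 h2
    by_contra h3
    rw [hcard] at h2
    exact Nat.find_min hex h2 ⟨c', h3, h1, rfl⟩
  clear hcard
  set T := Finset.univ.filter fun i => c i ≠ 0 with hT
  have hTmem : ∀ i, i ∈ T ↔ c i ≠ 0 := fun i => by simp [hT]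
  have hTne : T.Nonempty := by
    obtain ⟨i, hi⟩ := Function.ne_iff.1 hc
    exact ⟨i, (hTmem i).2 hi⟩
  let _ : NormalizedGCDMonoid ℂ[X] := UniqueFactorizationMonoid.toNormalizedGCDMonoid _
  obtain ⟨M, hM, hmax⟩ := Finset.exists_max_image T (fun i => (f i).natDegree) hTne
  obtain ⟨h, hfh, hgcd⟩ := Finset.extract_gcd f hTne
  set d := T.gcd f
  have hd0 : d ≠ 0 := by
    intro h0
    have := (hf M).ne_zero
    rw [hfh M hM, h0, zero_mul] at this
    exact this rfl
  have hh0 : ∀ i ∈ T, h i ≠ 0 := by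
    intro i hi h0
    have := (hf i).ne_zero
    rw [hfh i hi, h0, mul_zero] at this
    exact this rfl
  have hhdeg : ∀ i ∈ T, (h i).natDegree ≤ (h M).natDegree := by
    intro i hi
    have := hmax i hi
    rw [hfh i hi, hfh M hM, natDegree_mul hd0 (hh0 i hi), natDegree_mul hd0 (hh0 M hM)] at this
    omega
  have hsumT : ∑ i ∈ T, c i • h i ^ k = 0 := by
    have h1 : ∑ i ∈ T, c i • f i ^ k = 0 := by
      rw [← hsum]
      refine Finset.sum_subset (Finset.subset_univ _) fun i _ hi => ?_
      rw [hTmem, not_not] at hi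
      rw [hi, zero_smul]
    refine (mul_eq_zero.1 ?_).resolve_left (pow_ne_zero k hd0)
    rw [← h1, Finset.mul_sum]
    refine Finset.sum_congr rfl fun i hi => ?_
    rw [hfh i hi, mul_pow, mul_smul_comm]
  set T' := T.erase M with hT'
  have hT'T : ∀ i : T', (i : ι) ∈ T := fun i => Finset.mem_of_mem_erase i.2
  let e := T'.equivFin
  have hsume : ∀ F : ι → ℂ[X], ∑ i, F (e.symm i) = ∑ x ∈ T', F x := fun F =>
    (e.symm.sum_comp fun x : T' => F x).trans (Finset.sum_coe_sort T' F)
  have hcM : c M ≠ 0 := (hTmem M).1 hM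
  have hcardT : T'.card + 1 = T.card := Finset.card_erase_add_one hM
  have hrk : (T'.card + 1) ^ 2 ≤ k := by
    rw [hcardT]
    exact (Nat.pow_le_pow_left (Finset.card_le_univ T) 2).trans hk
  have hrel : h M ^ k = ∑ i, (-(c M)⁻¹ * c (e.symm i)) • h (e.symm i) ^ k := by
    rw [hsume fun x => (-(c M)⁻¹ * c x) • h x ^ k]
    rw [← Finset.add_sum_erase T _ hM, ← hT'] at hsumT
    simp_rw [mul_smul]
    rw [← Finset.smul_sum, eq_neg_of_add_eq_zero_right hsumT, smul_neg, neg_smul, neg_neg,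
      smul_smul, inv_mul_cancel₀ hcM, one_smul]
  have hli : LinearIndependent ℂ fun i => h (e.symm i) ^ k := by
    rw [Fintype.linearIndependent_iff]
    intro b hb i
    let c' : ι → ℂ := fun i => if hi : i ∈ T' then b (e ⟨i, hi⟩) else 0
    have hc'e : ∀ i, c' (e.symm i) = b i := fun i => by simp [c']
    have hc'0 : ∀ i, i ∉ T' → c' i = 0 := fun i hi => by simp [c', hi]
    have h1 : c' = 0 := by
      refine hmin c' ?_ ?_
      · rw [← Finset.sum_subset (Finset.subset_univ T') fun i _ hi => by
          rw [hc'0 i hi, zero_smul], ← hsume fun x => c' x • f x ^ k]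
        rw [← mul_zero (d ^ k), ← hb, Finset.mul_sum]
        refine Finset.sum_congr rfl fun i _ => ?_
        rw [hc'e, hfh _ (hT'T _), mul_pow, mul_smul_comm]
      · refine lt_of_le_of_lt (Finset.card_le_card (t := T') fun i hi => ?_) (by omega)
        by_contra h2
        exact (Finset.mem_filter.1 hi).2 (hc'0 i h2)
    rw [← hc'e, h1, Pi.zero_apply]
  have hMdeg := natDegree_eq_zero_of_pow_eq_sum hrk (hh0 M hM) (fun i => hh0 _ (hT'T (e.symm i)))
    (fun i => mul_ne_zero (neg_ne_zero.2 (inv_ne_zero hcM)) ((hTmem _).1 (hT'T (e.symm i))))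
    hrel hli (fun i => hhdeg _ (hT'T _)) fun a ha => by
      by_contra! hall
      have : X - C a ∣ T.gcd h := by
        refine Finset.dvd_gcd fun i hi => dvd_iff_isRoot.2 ?_
        rcases eq_or_ne i M with rfl | hiM
        · exact ha
        · simpa using hall (e ⟨i, Finset.mem_erase.2 ⟨hiM, hi⟩⟩)
      rw [hgcd] at this
      exact not_isUnit_X_sub_C a (isUnit_of_dvd_one this)
  have hT'ne : T'.Nonempty := by
    rw [Finset.nonempty_iff_ne_empty]
    intro h0
    have : IsEmpty (Fin T'.card) := by rw [h0]; exact Fin.isEmpty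
    rw [Finset.univ_eq_empty, Finset.sum_empty] at hrel
    exact hh0 M hM (eq_zero_of_pow_eq_zero hrel)
  obtain ⟨i, hi⟩ := hT'ne
  have hiT := Finset.mem_of_mem_erase hi
  refine ⟨i, M, Finset.ne_of_mem_erase hi, ?_⟩
  have e1 := eq_C_of_natDegree_eq_zero hMdeg
  have e2 := eq_C_of_natDegree_eq_zero (Nat.le_zero.1 ((hhdeg i hiT).trans hMdeg.le))
  have l1 := (hf M).leadingCoeff
  have l2 := (hf i).leadingCoeff
  rw [hfh M hM, e1, leadingCoeff_mul, leadingCoeff_C] at l1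
  rw [hfh i hiT, e2, leadingCoeff_mul, leadingCoeff_C] at l2
  rw [hfh M hM, hfh i hiT, e1, e2,
    mul_left_cancel₀ (leadingCoeff_ne_zero.2 hd0) (l1.trans l2.symm)]

/-! ### Coincidences among determinant terms. -/

theorem exists_perm_prod_eq {m k : ℕ} (hk : m.factorial ^ 2 ≤ k) {w y z : Fin m → Fin m → ℂ[X]}
    {x : Fin m → ℂ[X]} (hx : ∀ j, x j ≠ 0) (hy : ∀ i j, (y i j).Monic)
    (hz : ∀ i j, (z i j).Monic) (hw : ∀ i j, w i j * z i j ^ k = x j * y i j ^ k)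
    {a : Fin m → ℂ[X]} (ha : a ≠ 0) (hrel : ∀ i, ∑ j, w i j * a j = 0) :
    ∃ σ τ : Equiv.Perm (Fin m), σ ≠ τ ∧ ∏ i, w i (σ i) = ∏ i, w i (τ i) := by
  classical
  have hdet : (Matrix.of w).det = 0 :=
    Matrix.exists_mulVec_eq_zero_iff.1 ⟨a, ha, by
      funext i; simpa [Matrix.mulVec, dotProduct] using hrel i⟩
  rw [← Matrix.det_transpose, Matrix.det_apply] at hdet
  simp only [Matrix.transpose_apply, Matrix.of_apply] at hdet
  set Z : ℂ[X] := ∏ i, ∏ j, z i j with hZ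
  have hZ0 : Z ≠ 0 := Finset.prod_ne_zero_iff.2 fun i _ =>
    Finset.prod_ne_zero_iff.2 fun j _ => (hz i j).ne_zero
  have hX0 : ∏ j, x j ≠ 0 := Finset.prod_ne_zero_iff.2 fun j _ => hx j
  -- `F σ` is the k-th root left after clearing the denominators `Z ^ k`. The factor ∏ xⱼ does not
  -- depend on σ, since each column is used once.
  let F : Equiv.Perm (Fin m) → ℂ[X] := fun σ =>
    ∏ i, (y i (σ i) * ∏ j ∈ Finset.univ.erase (σ i), z i j)
  have hF : ∀ σ, (∏ i, w i (σ i)) * Z ^ k = (∏ j, x j) * F σ ^ k := by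
    intro σ
    rw [← Equiv.prod_comp σ x, hZ, ← Finset.prod_pow, ← Finset.prod_pow, ← Finset.prod_mul_distrib,
      ← Finset.prod_mul_distrib]
    refine Finset.prod_congr rfl fun i _ => ?_
    rw [← Finset.mul_prod_erase Finset.univ (z i) (Finset.mem_univ (σ i)), mul_pow, mul_pow,
      ← mul_assoc, hw, mul_assoc]
  have hFm : ∀ σ, (F σ).Monic := fun σ => monic_prod_of_monic _ _ fun i _ =>
    (hy i _).mul (monic_prod_of_monic _ _ fun j _ => hz i j)
  have hsum : ∑ σ : Equiv.Perm (Fin m), ((Equiv.Perm.sign σ : ℤ) : ℂ) • F σ ^ k = 0 := by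
    refine (mul_eq_zero.1 ?_).resolve_left hX0
    rw [Finset.mul_sum, ← zero_mul (Z ^ k), ← hdet, Finset.sum_mul]
    refine Finset.sum_congr rfl fun σ _ => ?_
    rw [smul_mul_assoc, hF, mul_smul_comm, Units.smul_def, Int.cast_smul_eq_zsmul]
  obtain ⟨σ, τ, hne, heq⟩ := exists_eq_of_sum_smul_pow_eq_zero
    (by rwa [Fintype.card_perm, Fintype.card_fin]) hFm
    (Function.ne_iff.2 ⟨1, by simp⟩) hsum
  refine ⟨σ, τ, hne, mul_right_cancel₀ (pow_ne_zero k hZ0) ?_⟩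
  rw [hF, hF, heq]

/-- Solutions of a linear equation whose coordinates lie in fixed classes modulo `k`-th powers:
a positive proportion of them has two coordinates in a constant ratio. -/
theorem exists_subset_proportional {α : Type*} {m k : ℕ} (hk : m.factorial ^ 2 ≤ k)
    (V : Finset α) (v : α → Fin m → ℂ[X]) {x : Fin m → ℂ[X]} (hx : ∀ j, x j ≠ 0)
    (hv : ∀ s ∈ V, ∀ j, ∃ y z : ℂ[X], y.Monic ∧ z.Monic ∧ v s j * z ^ k = x j * y ^ k)
    {a : Fin m → ℂ[X]} (ha : a ≠ 0) (hrel : ∀ s ∈ V, ∑ j, v s j * a j = 0) (hV : V.Nonempty) :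
    ∃ V' ⊆ V, V'.Nonempty ∧ V.card ≤ m.factorial ^ 2 * V'.card ∧ ∃ p q : Fin m, p ≠ q ∧
      ∀ s ∈ V', ∀ t ∈ V', v s p * v t q = v s q * v t p := by
  classical
  have hv0 : ∀ s ∈ V, ∀ j, v s j ≠ 0 := by
    intro s hs j h0
    obtain ⟨y, z, hy, hz, h⟩ := hv s hs j
    rw [h0, zero_mul] at h
    exact mul_ne_zero (hx j) (pow_ne_zero k hy.ne_zero) h.symm
  -- `G t w`: no coincidence between distinct permutations that differ only in the first t rows. It
  -- is trivial at t = 0 and impossible at t = m, so it breaks at some t. Then every solution placed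
  -- in row t creates a coincidence whose two permutations differ at t, which fixes a coordinate
  -- ratio in terms of `w`.
  let G : ℕ → (Fin m → α) → Prop := fun t w => ∀ σ τ : Equiv.Perm (Fin m),
    (∀ i : Fin m, t ≤ i → σ i = τ i) → ∏ i, v (w i) (σ i) = ∏ i, v (w i) (τ i) → σ = τ
  have hG0 : ∃ w : Fin m → α, (∀ i, w i ∈ V) ∧ G 0 w := by
    obtain ⟨s, hs⟩ := hV
    exact ⟨fun _ => s, fun _ => hs, fun σ τ h _ => Equiv.ext fun i => h i (Nat.zero_le _)⟩
  have hGm : ¬ ∃ w : Fin m → α, (∀ i, w i ∈ V) ∧ G m w := by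
    rintro ⟨w, hw, hG⟩
    choose y z hy hz hyz using fun i => hv (w i) (hw i)
    obtain ⟨σ, τ, hne, heq⟩ := exists_perm_prod_eq hk hx hy hz hyz ha fun i => hrel _ (hw i)
    exact hne (hG σ τ (fun i hi => absurd i.2 (by omega)) heq)
  obtain ⟨t, ht, ⟨w, hw, hGw⟩, hnext⟩ : ∃ t < m, (∃ w : Fin m → α, (∀ i, w i ∈ V) ∧ G t w) ∧
      ¬ ∃ w : Fin m → α, (∀ i, w i ∈ V) ∧ G (t + 1) w := by
    by_contra! hcon
    have : ∀ t ≤ m, ∃ w : Fin m → α, (∀ i, w i ∈ V) ∧ G t w := by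
      intro t
      induction t with
      | zero => exact fun _ => hG0
      | succ t ih => exact fun h => hcon t (by omega) (ih (by omega))
    exact hGm (this m le_rfl)
  have hcol : ∀ s ∈ V, ∃ π : Equiv.Perm (Fin m) × Equiv.Perm (Fin m),
      π.1 ⟨t, ht⟩ ≠ π.2 ⟨t, ht⟩ ∧
      v s (π.1 ⟨t, ht⟩) * ∏ i ∈ Finset.univ.erase ⟨t, ht⟩, v (w i) (π.1 i) =
      v s (π.2 ⟨t, ht⟩) * ∏ i ∈ Finset.univ.erase ⟨t, ht⟩, v (w i) (π.2 i) := by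
    intro s hs
    have hnot : ¬ G (t + 1) (Function.update w ⟨t, ht⟩ s) := fun hG => hnext ⟨_, fun i => by
      rcases eq_or_ne i ⟨t, ht⟩ with rfl | hi
      · simpa using hs
      · simpa [hi] using hw i, hG⟩
    simp only [G, not_forall] at hnot
    obtain ⟨σ, τ, hag, heq, hne⟩ := hnot
    have hprod : ∀ ρ : Equiv.Perm (Fin m), ∏ i, v (Function.update w ⟨t, ht⟩ s i) (ρ i) =
        v s (ρ ⟨t, ht⟩) * ∏ i ∈ Finset.univ.erase ⟨t, ht⟩, v (w i) (ρ i) := by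
      intro ρ
      rw [← Finset.mul_prod_erase _ _ (Finset.mem_univ (⟨t, ht⟩ : Fin m)), Function.update_self]
      congr 1
      refine Finset.prod_congr rfl fun i hi => ?_
      rw [Function.update_of_ne (Finset.ne_of_mem_erase hi)]
    rw [hprod, hprod] at heq
    refine ⟨(σ, τ), fun hst => hne ?_, heq⟩
    dsimp only at hst
    refine hGw σ τ (fun i hi => ?_) ?_
    · rcases eq_or_ne i ⟨t, ht⟩ with rfl | hi'
      · exact hst
      · refine hag i (Nat.succ_le_of_lt (lt_of_le_of_ne hi fun h => hi' (Fin.ext h.symm)))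
    · rw [hst] at heq
      rw [← Finset.mul_prod_erase _ _ (Finset.mem_univ (⟨t, ht⟩ : Fin m)),
        ← Finset.mul_prod_erase _ (fun i => v (w i) (τ i)) (Finset.mem_univ (⟨t, ht⟩ : Fin m)),
        hst, mul_left_cancel₀ (hv0 s hs _) heq]
  choose! π hπ hπ' using hcol
  obtain ⟨ρ, -, hρ⟩ := Finset.exists_max_image (Finset.univ : Finset (Equiv.Perm (Fin m) ×
    Equiv.Perm (Fin m))) (fun ρ => (V.filter fun s => π s = ρ).card) Finset.univ_nonempty
  have hcard : V.card ≤ m.factorial ^ 2 * (V.filter fun s => π s = ρ).card := by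
    have := Finset.card_le_mul_card_image_of_maps_to (f := π) (s := V) (t := Finset.univ)
      (fun _ _ => Finset.mem_univ _) _ (fun b _ => hρ b (Finset.mem_univ b))
    refine this.trans (le_of_eq ?_)
    rw [Finset.card_univ, Fintype.card_prod, Fintype.card_perm, Fintype.card_fin, ← sq, mul_comm]
  have hne : (V.filter fun s => π s = ρ).Nonempty := by
    rw [← Finset.card_pos]
    have := hV.card_pos
    by_contra h0
    rw [Nat.eq_zero_of_not_pos h0] at hcard
    omega
  refine ⟨_, Finset.filter_subset _ _, hne, hcard, ρ.1 ⟨t, ht⟩, ρ.2 ⟨t, ht⟩, ?_, ?_⟩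
  · obtain ⟨s, hs⟩ := hne
    obtain ⟨hsV, rfl⟩ := Finset.mem_filter.1 hs
    exact hπ s hsV
  · intro s hs s' hs'
    obtain ⟨hs, hs2⟩ := Finset.mem_filter.1 hs
    obtain ⟨hs', hs2'⟩ := Finset.mem_filter.1 hs'
    have e1 := hπ' s hs
    have e2 := hπ' s' hs'
    rw [hs2] at e1
    rw [hs2'] at e2
    have hA : ∏ i ∈ Finset.univ.erase ⟨t, ht⟩, v (w i) (ρ.1 i) ≠ 0 :=
      Finset.prod_ne_zero_iff.2 fun i _ => hv0 _ (hw i) _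
    have hB : ∏ i ∈ Finset.univ.erase ⟨t, ht⟩, v (w i) (ρ.2 i) ≠ 0 :=
      Finset.prod_ne_zero_iff.2 fun i _ => hv0 _ (hw i) _
    refine mul_left_cancel₀ (mul_ne_zero hA hB) ?_
    linear_combination (v s' (ρ.2 ⟨t, ht⟩) * ∏ i ∈ Finset.univ.erase ⟨t, ht⟩, v (w i) (ρ.2 i)) * e1
      - (v s (ρ.2 ⟨t, ht⟩) * ∏ i ∈ Finset.univ.erase ⟨t, ht⟩, v (w i) (ρ.2 i)) * e2

/-! ### Nontrivial solutions within a quadruple of classes. -/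

/-- If the second fixed ratio involves q, the relation supplies the remaining one. If it pairs r
with u, the two pairs could scale independently unless their partial sums are nonzero, whence `hw'`.
-/
theorem proportional_of_linear_relation {R : Type*} [CommRing R] [IsDomain R]
    {ε v w : Fin 4 → R} {p q r u : Fin 4} (hε : ∀ i, ε i ≠ 0) (hwq : w q ≠ 0) (hvq : v q ≠ 0)
    (hall : ∀ i, i = p ∨ i = q ∨ i = r ∨ i = u)
    (hv : v p * ε p + v q * ε q + v r * ε r + v u * ε u = 0)
    (hw : w p * ε p + w q * ε q + w r * ε r + w u * ε u = 0)
    (hw' : w p * ε p + w q * ε q ≠ 0) (hpq : v p * w q = v q * w p)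
    (h : v q * w r = v r * w q ∨ v q * w u = v u * w q ∨ v r * w u = v u * w r) (i j : Fin 4) :
    v i * w j = v j * w i := by
  have hru : v r * w q = v q * w r ∧ v u * w q = v q * w u := by
    rcases h with h | h | h
    · refine ⟨h.symm, mul_left_cancel₀ (hε u) ?_⟩
      linear_combination w q * hv - v q * hw - ε p * hpq + ε r * h
    · refine ⟨mul_left_cancel₀ (hε r) ?_, h.symm⟩
      linear_combination w q * hv - v q * hw - ε p * hpq + ε u * h
    · constructor
      · refine mul_left_cancel₀ hw' ?_
        linear_combination v r * w q * hw - w r * w q * hv + ε p * w r * hpq - ε u * w q * h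
      · refine mul_left_cancel₀ hw' ?_
        linear_combination v u * w q * hw - w u * w q * hv + ε p * w u * hpq + ε r * w q * h
  have key : ∀ i, v i * w q = v q * w i := by
    intro i
    rcases hall i with rfl | rfl | rfl | rfl
    · exact hpq
    · rfl
    · exact hru.1
    · exact hru.2
  refine mul_left_cancel₀ (mul_ne_zero hvq hwq) ?_
  linear_combination v q * w j * key i - v q * w i * key j

/-- Two rounds of pigeonhole, with four and then three terms, cost 20736 = (4!)²(3!)²; the first
needs k ≥ (4!)² = 576. -/
theorem exists_subset_all_proportional {α : Type*} {k : ℕ} (hk : 576 ≤ k) (V : Finset α)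
    (v : α → Fin 4 → ℂ[X]) {x : Fin 4 → ℂ[X]} (hx : ∀ j, x j ≠ 0)
    (hv : ∀ s ∈ V, ∀ j, ∃ y z : ℂ[X], y.Monic ∧ z.Monic ∧ v s j * z ^ k = x j * y ^ k)
    {ε : Fin 4 → ℂ[X]} (hε : ∀ i, ε i ≠ 0) (hrel : ∀ s ∈ V, ∑ j, v s j * ε j = 0)
    (hsub : ∀ s ∈ V, ∀ p q, p ≠ q → v s p * ε p + v s q * ε q ≠ 0) (hV : V.Nonempty) :
    ∃ V' ⊆ V, V'.Nonempty ∧ V.card ≤ 20736 * V'.card ∧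
      ∀ s ∈ V', ∀ t ∈ V', ∀ i j, v s i * v t j = v s j * v t i := by
  have hv0 : ∀ s ∈ V, ∀ j, v s j ≠ 0 := by
    intro s hs j h0
    obtain ⟨y, z, hy, hz, h⟩ := hv s hs j
    rw [h0, zero_mul] at h
    exact mul_ne_zero (hx j) (pow_ne_zero k hy.ne_zero) h.symm
  have hε0 : ε ≠ 0 := fun h => hε 0 (congrFun h 0)
  obtain ⟨V₁, hV₁, hne₁, hcard₁, p, q, hpq, hprop⟩ := exists_subset_proportional
    (by simpa [Nat.factorial] using hk) V v hx hv hε0 hrel hV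
  obtain ⟨r, u, hpr, hpu, hqr, hqu, hru, hall⟩ : ∃ r u : Fin 4, p ≠ r ∧ p ≠ u ∧ q ≠ r ∧ q ≠ u ∧
      r ≠ u ∧ ∀ i, i = p ∨ i = q ∨ i = r ∨ i = u := by
    clear hprop
    revert p q
    decide
  have hsum : ∀ F : Fin 4 → ℂ[X], ∑ i, F i = F p + F q + F r + F u := by
    intro F
    have : (Finset.univ : Finset (Fin 4)) = {p, q, r, u} := by
      ext i; simpa using hall i
    rw [this, Finset.sum_insert (by simp [hpq, hpr, hpu]), Finset.sum_insert (by simp [hqr, hqu]),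
      Finset.sum_insert (by simp [hru]), Finset.sum_singleton]
    ring
  simp only [hsum] at hrel
  obtain ⟨t, ht⟩ := hne₁
  let c : Fin 3 → Fin 4 := ![q, r, u]
  obtain ⟨V₂, hV₂, hne₂, hcard₂, p', q', hpq', hprop'⟩ := exists_subset_proportional (m := 3) (k := k)
    (by norm_num [Nat.factorial]; omega) V₁ (fun s j => v s (c j)) (x := fun j => x (c j))
    (fun j => hx _) (fun s hs j => hv s (hV₁ hs) (c j))
    -- On `V₁` the p-term is a fixed multiple of the q-term; merging them, with denominators cleared
    -- using the fixed solution t, leaves a three-term relation.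
    (a := ![v t p * ε p + v t q * ε q, v t q * ε r, v t q * ε u])
    (fun h => mul_ne_zero (hv0 t (hV₁ ht) q) (hε r) (by simpa using congrFun h 1))
    (fun s hs => by
      simp only [Fin.sum_univ_three, c]
      simp only [Matrix.cons_val]
      linear_combination v t q * hrel s (hV₁ hs) - ε p * hprop s hs t ht)
    ⟨t, ht⟩
  refine ⟨V₂, hV₂.trans hV₁, hne₂, ?_, ?_⟩
  · norm_num [Nat.factorial] at hcard₁ hcard₂
    omega
  · intro s hs s' hs'
    have hs1 := hV₁ (hV₂ hs)
    have hs1' := hV₁ (hV₂ hs')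
    refine proportional_of_linear_relation hε (hv0 s' hs1' q) (hv0 s hs1 q) hall (hrel s hs1)
      (hrel s' hs1') (hsub s' hs1' p q hpq) (hprop s (hV₂ hs) s' (hV₂ hs')) ?_
    have h := hprop' s hs s' hs'
    revert h hpq'
    clear hprop'
    fin_cases p' <;> fin_cases q' <;> simp [c] <;> intro h <;> simp [h]

theorem add_ne_zero_of_monic {a b : ℂ[X]} (ha : a.Monic) (hb : b.Monic) : a + b ≠ 0 := by
  intro h
  have h1 := ha.leadingCoeff
  rw [eq_neg_of_add_eq_zero_left h, leadingCoeff_neg, hb.leadingCoeff] at h1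
  norm_num at h1

theorem card_nontrivial_solutions_le {k : ℕ} (hk : 576 ≤ k) {S : Finset ℂ[X]}
    (hS : ∀ f ∈ S, f.Monic) {x : Fin 4 → ℂ[X]} (hx : ∀ j, x j ≠ 0)
    (V : Finset ((ℂ[X] × ℂ[X]) × ℂ[X] × ℂ[X])) (hVS : V ⊆ (S ×ˢ S) ×ˢ S ×ˢ S)
    (hV : ∀ s ∈ V, s.1.1 + s.2.1 = s.1.2 + s.2.2 ∧ s.1.1 ≠ s.1.2 ∧ s.1.1 ≠ s.2.2)
    (hv : ∀ s ∈ V, ∀ j, ∃ y z : ℂ[X], y.Monic ∧ z.Monic ∧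
      ![s.1.1, s.2.1, s.1.2, s.2.2] j * z ^ k = x j * y ^ k) :
    V.card ≤ 20736 * S.card := by
  rcases V.eq_empty_or_nonempty with rfl | hne
  · simp
  have hmem : ∀ s ∈ V, s.1.1 ∈ S ∧ s.1.2 ∈ S ∧ s.2.1 ∈ S ∧ s.2.2 ∈ S := fun s hs => by
    have := hVS hs
    simp only [Finset.mem_product] at this
    tauto
  obtain ⟨V', hV', -, hcard, hprop⟩ := exists_subset_all_proportional hk V
    (fun s => ![s.1.1, s.2.1, s.1.2, s.2.2]) hx hv (ε := ![1, 1, -1, -1])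
    (fun i => by fin_cases i <;> simp)
    (fun s hs => by
      simp only [Fin.sum_univ_four, Matrix.cons_val]
      linear_combination (hV s hs).1)
    -- Same-side pairs sum to a nonzero polynomial by monicity; opposite-side pairs do so by
    -- nontriviality.
    (fun s hs p q hpq => by
      obtain ⟨h1, h2, h3⟩ := hV s hs
      obtain ⟨m1, m2, m3, m4⟩ := hmem s hs
      have n1 := add_ne_zero_of_monic (hS _ m1) (hS _ m3)
      have n2 := add_ne_zero_of_monic (hS _ m2) (hS _ m4)
      intro h0
      revert h0 hpq
      fin_cases p <;> fin_cases q <;> simp <;> intro h0 <;>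
        first
        | exact n1 h0
        | exact n1 (by linear_combination h0)
        | exact n2 (by linear_combination -h0)
        | exact h2 (by linear_combination h0)
        | exact h2 (by linear_combination -h0)
        | exact h2 (by linear_combination h1 - h0)
        | exact h2 (by linear_combination h1 + h0)
        | exact h3 (by linear_combination h0)
        | exact h3 (by linear_combination -h0)
        | exact h3 (by linear_combination h1 - h0)) hne
  refine hcard.trans (Nat.mul_le_mul_left _ (Finset.card_le_card_of_injOn (fun s => s.1.1)
    (fun s hs => (hmem s (hV' hs)).1) ?_))
  intro s hs t ht hst
  have hs0 := (hS _ (hmem s (hV' hs)).1).ne_zero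
  have h := hprop s hs t ht 0
  dsimp only at hst
  have h1 := h 1
  have h2 := h 2
  have h3 := h 3
  simp only [Matrix.cons_val] at h1 h2 h3
  rw [← hst, mul_comm _ s.1.1] at h1 h2 h3
  have e1 := mul_left_cancel₀ hs0 h1
  have e2 := mul_left_cancel₀ hs0 h2
  have e3 := mul_left_cancel₀ hs0 h3
  exact Prod.ext (Prod.ext hst e2.symm) (Prod.ext e1.symm e3.symm)

/-- Each of the two trivial families has at most |S|² members; the remaining solutions are sorted by
their quadruple of classes. -/
theorem addEnergy_le_of_power_classes [DecidableEq ℂ[X]] {k : ℕ} (hk : 576 ≤ k) {S F : Finset ℂ[X]}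
    (hS : ∀ f ∈ S, f.Monic) (hFS : F ⊆ S)
    (hF : ∀ s ∈ S, ∃ x ∈ F, ∃ y ∈ S, ∃ z ∈ S, s * z ^ k = x * y ^ k) :
    S.addEnergy S ≤ 2 * S.card ^ 2 + 20736 * S.card * F.card ^ 4 := by
  choose! cl hcl y hy z hz hyz using hF
  set T : Finset ((ℂ[X] × ℂ[X]) × ℂ[X] × ℂ[X]) :=
    {x ∈ (S ×ˢ S) ×ˢ S ×ˢ S | x.1.1 + x.2.1 = x.1.2 + x.2.2} with hT
  set Q := T.filter fun x => x.1.1 ≠ x.1.2 ∧ x.1.1 ≠ x.2.2 with hQ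
  have hmem : ∀ s ∈ T, (s.1.1 ∈ S ∧ s.1.2 ∈ S ∧ s.2.1 ∈ S ∧ s.2.2 ∈ S) ∧
      s.1.1 + s.2.1 = s.1.2 + s.2.2 := fun s hs => by
    simp only [hT, Finset.mem_filter, Finset.mem_product] at hs
    tauto
  have hsplit : T ⊆ (T.filter fun x => x.1.1 = x.1.2) ∪ (T.filter fun x => x.1.1 = x.2.2) ∪ Q := by
    intro s hs
    simp only [hQ, Finset.mem_union, Finset.mem_filter]
    tauto
  have h1 : (T.filter fun x => x.1.1 = x.1.2).card ≤ S.card ^ 2 := by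
    rw [sq, ← Finset.card_product]
    refine Finset.card_le_card_of_injOn (fun s => (s.1.1, s.2.1)) (fun s hs => ?_) ?_
    · have := hmem s (Finset.mem_filter.1 hs).1
      exact Finset.mem_coe.2 (Finset.mem_product.2 ⟨this.1.1, this.1.2.2.1⟩)
    · intro s hs t ht hst
      obtain ⟨hs1, hs2⟩ := Finset.mem_filter.1 hs
      obtain ⟨ht1, ht2⟩ := Finset.mem_filter.1 ht
      have es := (hmem s hs1).2
      have et := (hmem t ht1).2
      obtain ⟨ha, hb⟩ := Prod.mk.inj hst
      refine Prod.ext (Prod.ext ha (by rw [← hs2, ← ht2, ha])) (Prod.ext hb ?_)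
      linear_combination hs2 - ht2 - es + et + hb
  have h2 : (T.filter fun x => x.1.1 = x.2.2).card ≤ S.card ^ 2 := by
    rw [sq, ← Finset.card_product]
    refine Finset.card_le_card_of_injOn (fun s => (s.1.1, s.2.1)) (fun s hs => ?_) ?_
    · have := hmem s (Finset.mem_filter.1 hs).1
      exact Finset.mem_coe.2 (Finset.mem_product.2 ⟨this.1.1, this.1.2.2.1⟩)
    · intro s hs t ht hst
      obtain ⟨hs1, hs2⟩ := Finset.mem_filter.1 hs
      obtain ⟨ht1, ht2⟩ := Finset.mem_filter.1 ht
      have es := (hmem s hs1).2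
      have et := (hmem t ht1).2
      obtain ⟨ha, hb⟩ := Prod.mk.inj hst
      refine Prod.ext (Prod.ext ha ?_) (Prod.ext hb (by rw [← hs2, ← ht2, ha]))
      linear_combination hs2 - ht2 - es + et + hb
  have h3 : Q.card ≤ 20736 * S.card * F.card ^ 4 := by
    have := Finset.card_le_mul_card_image_of_maps_to (s := Q) (t := (F ×ˢ F) ×ˢ F ×ˢ F)
      (f := fun s => ((cl s.1.1, cl s.1.2), cl s.2.1, cl s.2.2)) (fun s hs => by
        obtain ⟨h, -⟩ := hmem s (Finset.mem_filter.1 hs).1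
        simp only [Finset.mem_product]
        exact ⟨⟨hcl _ h.1, hcl _ h.2.1⟩, hcl _ h.2.2.1, hcl _ h.2.2.2⟩) (20736 * S.card) (by
        rintro ⟨⟨x0, x2⟩, x1, x3⟩ hx
        simp only [Finset.mem_product] at hx
        refine card_nontrivial_solutions_le hk hS (x := ![x0, x1, x2, x3]) ?_ _ ?_ ?_ ?_
        · have := fun f hf => (hS f (hFS hf)).ne_zero
          intro j
          fin_cases j
          exacts [this _ hx.1.1, this _ hx.2.1, this _ hx.1.2, this _ hx.2.2]
        · exact (Finset.filter_subset _ _).trans ((Finset.filter_subset _ _).trans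
            (Finset.filter_subset _ _))
        · intro s hs
          obtain ⟨hs, h⟩ := Finset.mem_filter.1 (Finset.mem_filter.1 hs).1
          exact ⟨(hmem s hs).2, h⟩
        · intro s hs j
          obtain ⟨hs, h⟩ := Finset.mem_filter.1 hs
          obtain ⟨hm, -⟩ := hmem s (Finset.mem_filter.1 hs).1
          simp only [Prod.mk.injEq] at h
          obtain ⟨⟨rfl, rfl⟩, rfl, rfl⟩ := h
          have := fun f hf => (⟨y f, z f, hS _ (hy f hf), hS _ (hz f hf), hyz f hf⟩ :
            ∃ y z : ℂ[X], y.Monic ∧ z.Monic ∧ f * z ^ k = cl f * y ^ k)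
          fin_cases j
          exacts [this _ hm.1, this _ hm.2.2.1, this _ hm.2.1, this _ hm.2.2.2])
    refine this.trans (le_of_eq ?_)
    simp only [Finset.card_product]
    ring
  calc S.addEnergy S = T.card := rfl
    _ ≤ _ := Finset.card_le_card hsplit
    _ ≤ _ := (Finset.card_union_le _ _).trans (Nat.add_le_add_right (Finset.card_union_le _ _) _)
    _ ≤ _ := by omega

/-! ### Covering by classes modulo k-th powers, and conclusion. -/

theorem Polynomial.Monic.eq_of_pow_eq {k : ℕ} (hk : k ≠ 0) {a b : ℂ[X]} (ha : a.Monic)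
    (hb : b.Monic) (h : a ^ k = b ^ k) : a = b :=
  eq_of_monic_of_associated ha hb (associated_of_dvd_dvd
    ((UniqueFactorizationMonoid.pow_dvd_pow_iff_dvd hk).1 (dvd_of_eq h))
    ((UniqueFactorizationMonoid.pow_dvd_pow_iff_dvd hk).1 (dvd_of_eq h.symm)))

/-- A finite set of small doubling in a commutative group is covered by few pieces
`x * (y / z) ^ k`. -/
theorem exists_power_classes_of_group {G : Type*} [CommGroup G] [DecidableEq G] {A : Finset G}
    (hA : A.Nonempty) {k : ℕ} (hinj : Set.InjOn (· ^ k) (A : Set G)) {δ : ℝ}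
    (hδ : ((A * A).card : ℝ) ≤ (A.card : ℝ) ^ (1 + δ)) :
    ∃ F ⊆ A, (F.card : ℝ) ≤ (A.card : ℝ) ^ (δ * (k + 1 : ℕ)) ∧
      ∀ s ∈ A, ∃ x ∈ F, ∃ y ∈ A, ∃ z ∈ A, s = x * (y ^ k / z ^ k) := by
  have hn : (0 : ℝ) < A.card := by exact_mod_cast hA.card_pos
  set B := A.image (· ^ k) with hB
  have hBcard : B.card = A.card := Finset.card_image_of_injOn hinj
  -- This is why k + 1 is the exponent: the k-th powers have as many elements as A, yet A times them
  -- stays inside an iterated product set.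
  have hAB : A * B ⊆ A ^ (k + 1) := by
    rw [pow_succ']
    refine Finset.mul_subset_mul_left fun b hb => ?_
    obtain ⟨a, ha, rfl⟩ := Finset.mem_image.1 hb
    exact Finset.pow_mem_pow ha
  have hpr : ((A ^ (k + 1)).card : ℝ) ≤ ((A * A).card / A.card : ℝ) ^ (k + 1) * A.card := by
    have h := (NNRat.cast_le (K := ℝ)).2 (Finset.pluennecke_ruzsa_inequality_pow_mul hA A (k + 1))
    push_cast at h
    exact h
  have hK : ((A * B).card : ℝ) ≤ (A.card : ℝ) ^ (δ * (k + 1 : ℕ)) * B.card := by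
    rw [hBcard]
    refine (Nat.cast_le.2 (Finset.card_le_card hAB)).trans (hpr.trans ?_)
    refine mul_le_mul_of_nonneg_right ?_ hn.le
    rw [Real.rpow_mul hn.le, Real.rpow_natCast]
    refine pow_le_pow_left₀ (by positivity) ?_ _
    rw [div_le_iff₀ hn]
    refine hδ.trans (le_of_eq ?_)
    rw [add_comm, Real.rpow_add hn, Real.rpow_one]
  obtain ⟨F, hFA, hF, hcov⟩ := Finset.ruzsa_covering_mul (hA.image _) hK
  refine ⟨F, hFA, hF, fun s hs => ?_⟩
  obtain ⟨x, hx, t, ht, rfl⟩ := Finset.mem_mul.1 (hcov hs)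
  obtain ⟨b, hb, c, hc, rfl⟩ := Finset.mem_div.1 ht
  obtain ⟨y, hy, rfl⟩ := Finset.mem_image.1 hb
  obtain ⟨z, hz, rfl⟩ := Finset.mem_image.1 hc
  exact ⟨x, hx, y, hy, z, hz, rfl⟩

theorem exists_power_classes [DecidableEq ℂ[X]] {S : Finset ℂ[X]} (hS : ∀ f ∈ S, f.Monic)
    (hne : S.Nonempty) {k : ℕ} (hk : k ≠ 0) {δ : ℝ}
    (hδ : ((S * S).card : ℝ) ≤ (S.card : ℝ) ^ (1 + δ)) :
    ∃ F ⊆ S, (F.card : ℝ) ≤ (S.card : ℝ) ^ (δ * (k + 1 : ℕ)) ∧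
      ∀ s ∈ S, ∃ x ∈ F, ∃ y ∈ S, ∃ z ∈ S, s * z ^ k = x * y ^ k := by
  classical
  let φ : ℂ[X] → (RatFunc ℂ)ˣ := fun p =>
    if h : p = 0 then 1 else Units.mk0 (algebraMap ℂ[X] (RatFunc ℂ) p) (RatFunc.algebraMap_ne_zero h)
  have hφ : ∀ p ≠ 0, (φ p : RatFunc ℂ) = algebraMap ℂ[X] (RatFunc ℂ) p := fun p hp => by
    simp [φ, hp]
  have hS0 : ∀ f ∈ S, f ≠ 0 := fun f hf => (hS f hf).ne_zero
  have hφinj : ∀ {p q : ℂ[X]}, p ≠ 0 → q ≠ 0 → φ p = φ q → p = q := by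
    intro p q hp hq h
    have := congrArg Units.val h
    rw [hφ p hp, hφ q hq] at this
    exact RatFunc.algebraMap_injective ℂ this
  have hφmul : ∀ {p q : ℂ[X]}, p ≠ 0 → q ≠ 0 → φ (p * q) = φ p * φ q := by
    intro p q hp hq
    ext1
    rw [hφ _ (mul_ne_zero hp hq), Units.val_mul, hφ p hp, hφ q hq, map_mul]
  have hφpow : ∀ {p : ℂ[X]} (m : ℕ), p ≠ 0 → φ (p ^ m) = φ p ^ m := by
    intro p m hp
    ext1
    rw [hφ _ (pow_ne_zero m hp), Units.val_pow_eq_pow_val, hφ p hp, map_pow]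
  set A := S.image φ with hA
  have hAcard : A.card = S.card := Finset.card_image_of_injOn fun p hp q hq h =>
    hφinj (hS0 p hp) (hS0 q hq) h
  have hAA : A * A ⊆ (S * S).image φ := by
    intro g hg
    obtain ⟨a, ha, b, hb, rfl⟩ := Finset.mem_mul.1 hg
    obtain ⟨p, hp, rfl⟩ := Finset.mem_image.1 ha
    obtain ⟨q, hq, rfl⟩ := Finset.mem_image.1 hb
    rw [← hφmul (hS0 p hp) (hS0 q hq)]
    exact Finset.mem_image_of_mem _ (Finset.mul_mem_mul hp hq)
  have hinj : Set.InjOn (· ^ k) (A : Set (RatFunc ℂ)ˣ) := by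
    intro a ha b hb hab
    obtain ⟨p, hp, rfl⟩ := Finset.mem_image.1 (Finset.mem_coe.1 ha)
    obtain ⟨q, hq, rfl⟩ := Finset.mem_image.1 (Finset.mem_coe.1 hb)
    dsimp only at hab
    rw [← hφpow k (hS0 p hp), ← hφpow k (hS0 q hq)] at hab
    rw [(hS p hp).eq_of_pow_eq hk (hS q hq)
      (hφinj (pow_ne_zero k (hS0 p hp)) (pow_ne_zero k (hS0 q hq)) hab)]
  obtain ⟨F, hFA, hF, hcov⟩ := exists_power_classes_of_group (hne.image φ) hinj (δ := δ) (by
    rw [← hA, hAcard]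
    exact (Nat.cast_le.2 ((Finset.card_le_card hAA).trans Finset.card_image_le)).trans hδ)
  rw [← hA, hAcard] at hF
  refine ⟨S.filter fun p => φ p ∈ F, Finset.filter_subset _ _, le_trans (Nat.cast_le.2 ?_) hF, ?_⟩
  · refine Finset.card_le_card_of_injOn φ (fun p hp => (Finset.mem_filter.1 hp).2) ?_
    intro p hp q hq h
    exact hφinj (hS0 p (Finset.mem_filter.1 hp).1) (hS0 q (Finset.mem_filter.1 hq).1) h
  · intro s hs
    obtain ⟨x, hx, y, hy, z, hz, h⟩ := hcov (φ s) (Finset.mem_image_of_mem _ hs)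
    obtain ⟨x, hxS, rfl⟩ := Finset.mem_image.1 (hFA hx)
    obtain ⟨y, hyS, rfl⟩ := Finset.mem_image.1 hy
    obtain ⟨z, hzS, rfl⟩ := Finset.mem_image.1 hz
    refine ⟨x, Finset.mem_filter.2 ⟨hxS, hx⟩, y, hyS, z, hzS, ?_⟩
    have hz0 := pow_ne_zero k (hS0 z hzS)
    have hy0 := pow_ne_zero k (hS0 y hyS)
    refine hφinj (mul_ne_zero (hS0 s hs) hz0) (mul_ne_zero (hS0 x hxS) hy0) ?_
    rw [hφmul (hS0 s hs) hz0, hφmul (hS0 x hxS) hy0, hφpow k (hS0 z hzS), hφpow k (hS0 y hyS), h,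
      mul_assoc, div_mul_cancel]

theorem theorem1 [DecidableEq ℂ[X]] :
    ∃ c : ℝ, 0 < c ∧ ∃ κ : ℝ, 0 < κ ∧ ∃ N : ℕ,
      ∀ n : ℕ, N ≤ n → ∀ S : Finset ℂ[X], S.card = n → (∀ f ∈ S, f.Monic) →
        ((S * S).card : ℝ) < (n : ℝ) ^ (1 + c) →
          κ * (n : ℝ) ^ 2 ≤ ((S + S).card : ℝ) := by
  -- With k = 576, the exponent c(k + 1) = 1/4 gives |F|⁴ ≤ n, and 20738 = 20736 + 2 bounds the
  -- energy divided by n².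
  refine ⟨1 / (4 * 577), by norm_num, 1 / 20738, by norm_num, 1, ?_⟩
  rintro n hn S rfl hS hSS
  have hne : S.Nonempty := Finset.card_pos.1 hn
  obtain ⟨F, hFS, hF, hcov⟩ := exists_power_classes hS hne (k := 576) (by norm_num) hSS.le
  have hn0 : (0 : ℝ) < S.card := by exact_mod_cast hn
  have hF4 : F.card ^ 4 ≤ S.card := by
    have h := pow_le_pow_left₀ (Nat.cast_nonneg _) hF 4
    rw [← Real.rpow_natCast _ 4, ← Real.rpow_natCast _ 4, ← Real.rpow_mul hn0.le] at h
    norm_num at h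
    exact_mod_cast h
  have hE := addEnergy_le_of_power_classes le_rfl hS hFS hcov
  have hE' : S.addEnergy S ≤ 20738 * S.card ^ 2 := by nlinarith
  have hCS := (Finset.le_card_add_mul_addEnergy S S).trans (Nat.mul_le_mul_left _ hE')
  have hfin : S.card ^ 2 ≤ (S + S).card * 20738 := by
    refine Nat.le_of_mul_le_mul_right (c := S.card ^ 2) ?_ (by positivity)
    linarith
  have : (S.card : ℝ) ^ 2 ≤ (S + S).card * 20738 := by exact_mod_cast hfin
  linarith
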